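/- Let $J$ be a number of bosonic modes with Fock space $\mathcal H$, photon-number states $|\boldsymbol m\rangle$, $\boldsymbol m\in\mathbb N_0^J$, creation operators $\hat a_k^\dagger$, vacuum $|\boldsymbol 0\rangle$, and coherent states $|\alpha\rangle$, $\alpha\in\mathbb C^J$. For a positive-definite matrix $\Gamma\in\mathbb C^{J\times J}$ the thermal state with mutual coherence matrix $\Gamma$ is the density operator $$\rho_\Gamma=\int_{\mathbb C^J}\frac{\exp(-\alpha^\dagger\Gamma^{-1}\alpha)}{\det(\pi\Gamma)}\,|\alpha\rangle\langle\alpha|\,d^{2J}\alpha .$$ Let $\{\Gamma_x:x\in\mathcal X\}$ be a family of positive-definite matrices, indexed by an arbitrary parameter set, whose eigenmodes do not depend on $x$: there is a fixed unitary matrix $V$ such that $\Gamma_x=V\,\mathrm{diag}(\lambda_{1,x},\dots,\lambda_{J,x})\,V^\dagger$ for all $x\in\mathcal X$. Put $\rho_x=\rho_{\Gamma_x}$, $\hat g_j^\dagger=\sum_k V_{kj}\hat a_k^\dagger$ (the creation operators of the eigenmodes) and $|\boldsymbol m,g\rangle=\prod_j\frac{(\hat g_j^\dagger)^{m_j}}{\sqrt{m_j!}}|\boldsymbol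 0\rangle$. Let $a:\mathcal X\to\mathbb R$ be any real parameter of interest (in particular, any function of the spectrum $(\lambda_{1,x},\dots,\lambda_{J,x})$). For a POVM $M$ on a measurable space $\mathcal Y$ with values in the bounded operators on $\mathcal H$, and a measurable estimator $b:\mathcal Y\to\mathbb R$, the local mean-square error is $$\mathrm{MSE}_x(M,b)=\int_{\mathcal Y}[b(y)-a(x)]^2\,\mathrm{tr}\,(M(dy)\rho_x)\in[0,\infty].$$ Then photon counting in the eigenmodes is a measurement, i.e. there is a POVM $N$ on $\mathbb N_0^J$ with $N(\{\boldsymbol m\})=|\boldsymbol m,g\rangle\langle\boldsymbol m,g|$ for all $\boldsymbol m$, and for every measurable space $\mathcal Y$, every POVM $M$ on $\mathcal Y$ and every measurable estimator $b:\mathcal Y\to\mathbb R$ there is an estimator $b':\mathbb N_0^J\to\mathbb R$, not depending on $x$, such that $$\mathrm{MSE}_x(N,b')\le \mathrm{MSE}_x(M,b)\qquad\text{for all }x\in\mathcal X .$$ -/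

import Mathlib

open scoped ENNReal InnerProductSpace ComplexOrder
open MeasureTheory

/-- The Fock space of `J` bosonic modes, as the space of square-summable families of amplitudes
indexed by the photon numbers `m = (m_1, ..., m_J)`. -/
abbrev FockSpace (J : ℕ) : Type := lp (fun _ : Fin J → ℕ => ℂ) 2

/-- The photon-number state `|m⟩` of the original modes. -/
noncomputable def fockState {J : ℕ} (m : Fin J → ℕ) : FockSpace J := lp.single 2 m 1

/-- The trace `∑ m, ⟨m|T|m⟩`. -/
noncomputable def fockTrace {J : ℕ} (T : FockSpace J →L[ℂ] FockSpace J) : ℂ :=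
  ∑' m, ⟪fockState m, T (fockState m)⟫_ℂ

/-- A density operator: positive, with trace one. -/
structure DensityOperator (J : ℕ) where
  op : FockSpace J →L[ℂ] FockSpace J
  positive : op.IsPositive
  trace_one : HasSum (fun m => ⟪fockState m, op (fockState m)⟫_ℂ) 1

/-- A positive operator-valued measure on the outcome space `Y`: positive effects, weakly countably
additive on measurable sets, with total effect the identity. -/
structure POVM (H : Type*) [NormedAddCommGroup H] [InnerProductSpace ℂ H]
    (Y : Type*) [MeasurableSpace Y] where
  effect : Set Y → (H →L[ℂ] H)
  positive : ∀ C, MeasurableSet C → (effect C).IsPositive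
  effect_univ : effect Set.univ = 1
  hasSum_iUnion : ∀ C : ℕ → Set Y, (∀ n, MeasurableSet (C n)) →
    Pairwise (Function.onFun Disjoint C) → ∀ φ ψ : H,
      HasSum (fun n => ⟪φ, effect (C n) ψ⟫_ℂ) ⟪φ, effect (⋃ n, C n) ψ⟫_ℂ

theorem hasSum_norm_sq_inner {ι H : Type*} [NormedAddCommGroup H] [InnerProductSpace ℂ H]
    (e : HilbertBasis ι ℂ H) (ψ : H) : HasSum (fun m => ‖⟪e m, ψ⟫_ℂ‖ ^ 2) (‖ψ‖ ^ 2) := by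
  have h := Complex.hasSum_re (e.hasSum_inner_mul_inner ψ ψ)
  rw [inner_self_eq_norm_sq_to_K] at h
  convert h using 1
  · ext m
    rw [← inner_conj_symm ψ, Complex.conj_mul']
    norm_cast
  · norm_cast

theorem exists_trace_factor {ι H : Type*} [NormedAddCommGroup H] [InnerProductSpace ℂ H]
    [CompleteSpace H] (e : HilbertBasis ι ℂ H) (R : H →L[ℂ] H) (hR : R.IsPositive)
    (hsum : Summable fun m => ⟪e m, R (e m)⟫_ℂ) :
    ∃ ψ : ι → H, ∀ T : H →L[ℂ] H,
      HasSum (fun k => ⟪ψ k, T (ψ k)⟫_ℂ) (∑' m, ⟪e m, (T ∘L R) (e m)⟫_ℂ) := by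
  obtain ⟨S, hSp, hSS⟩ : ∃ S : H →L[ℂ] H, S.IsPositive ∧ ∀ v, S (S v) = R v := by
    have h0 : (0 : H →L[ℂ] H) ≤ R := (ContinuousLinearMap.nonneg_iff_isPositive _).2 hR
    refine ⟨CFC.sqrt R, (ContinuousLinearMap.nonneg_iff_isPositive _).1 (CFC.sqrt_nonneg _),
      fun v => ?_⟩
    exact DFunLike.congr_fun (CFC.sqrt_mul_sqrt_self R h0) v
  have hsym : ∀ u v, ⟪S u, v⟫_ℂ = ⟪u, S v⟫_ℂ := hSp.inner_left_eq_inner_right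
  have hn : Summable fun k => ‖S (e k)‖ ^ 2 := by
    refine Complex.summable_ofReal.1 (hsum.congr fun k => ?_)
    rw [← hSS, ← hsym, inner_self_eq_norm_sq_to_K]
    norm_cast
  refine ⟨fun k => S (e k), fun T => ?_⟩
  have hGs : Summable fun p : ι × ι =>
      ‖⟪e p.2, S (e p.1)⟫_ℂ‖ ^ 2 + ‖⟪e p.2, T (S (e p.1))⟫_ℂ‖ ^ 2 := by
    refine (summable_prod_of_nonneg fun p => add_nonneg (sq_nonneg _) (sq_nonneg _)).2 ?_
    have key : ∀ k, HasSum (fun m => ‖⟪e m, S (e k)⟫_ℂ‖ ^ 2 + ‖⟪e m, T (S (e k))⟫_ℂ‖ ^ 2)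
        (‖S (e k)‖ ^ 2 + ‖T (S (e k))‖ ^ 2) := fun k =>
      (hasSum_norm_sq_inner e (S (e k))).add (hasSum_norm_sq_inner e (T (S (e k))))
    refine ⟨fun k => (key k).summable, ?_⟩
    refine Summable.congr ?_ fun k => (key k).tsum_eq.symm
    refine hn.add (Summable.of_nonneg_of_le (fun k => sq_nonneg _) (fun k => ?_)
      (hn.mul_left (‖T‖ ^ 2)))
    rw [← mul_pow]
    exact pow_le_pow_left₀ (norm_nonneg _) (T.le_opNorm _) 2
  have hFs : Summable fun p : ι × ι => ⟪S (e p.1), e p.2⟫_ℂ * ⟪e p.2, T (S (e p.1))⟫_ℂ := by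
    refine Summable.of_norm_bounded hGs fun p => ?_
    rw [norm_mul, norm_inner_symm]
    have h1 := two_mul_le_add_sq ‖⟪e p.2, S (e p.1)⟫_ℂ‖ ‖⟪e p.2, T (S (e p.1))⟫_ℂ‖
    have h0 := mul_nonneg (norm_nonneg ⟪e p.2, S (e p.1)⟫_ℂ)
      (norm_nonneg ⟪e p.2, T (S (e p.1))⟫_ℂ)
    linarith
  have h2 : ∀ m, HasSum (fun k => ⟪S (e k), e m⟫_ℂ * ⟪e m, T (S (e k))⟫_ℂ)
      ⟪e m, (T ∘L R) (e m)⟫_ℂ := by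
    intro m
    have h := e.hasSum_inner_mul_inner (S (T.adjoint (e m))) (S (e m))
    have h3 : ⟪S (T.adjoint (e m)), S (e m)⟫_ℂ = ⟪e m, (T ∘L R) (e m)⟫_ℂ := by
      rw [hsym, hSS, ContinuousLinearMap.adjoint_inner_left]
      rfl
    rw [h3] at h
    refine h.congr_fun fun k => ?_
    rw [hsym, hsym, ContinuousLinearMap.adjoint_inner_left, mul_comm]
  have h3 := hFs.hasSum.prod_fiberwise fun k => e.hasSum_inner_mul_inner (S (e k)) (T (S (e k)))
  have h4 := ((Equiv.prodComm ι ι).hasSum_iff.2 hFs.hasSum).prod_fiberwise h2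
  rw [h4.tsum_eq]
  exact h3

/-- The photon-number states form a Hilbert basis. -/
noncomputable def fockBasis (J : ℕ) : HilbertBasis (Fin J → ℕ) ℂ (FockSpace J) :=
  HilbertBasis.ofRepr (LinearIsometryEquiv.refl ℂ (FockSpace J))

theorem fockBasis_apply {J : ℕ} (m : Fin J → ℕ) : fockBasis J m = fockState m := by
  rw [← HilbertBasis.repr_symm_single]
  rfl

theorem DensityOperator.exists_factor {J : ℕ} (ρ : DensityOperator J) :
    ∃ ψ : (Fin J → ℕ) → FockSpace J, ∀ T : FockSpace J →L[ℂ] FockSpace J,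
      HasSum (fun k => ⟪ψ k, T (ψ k)⟫_ℂ) (fockTrace (T ∘L ρ.op)) := by
  have h := exists_trace_factor (fockBasis J) ρ.op ρ.positive
    (by simpa only [fockBasis_apply] using ρ.trace_one.summable)
  simpa only [fockBasis_apply, fockTrace] using h

theorem POVM.effect_empty {H : Type*} [NormedAddCommGroup H] [InnerProductSpace ℂ H]
    {Y : Type*} [MeasurableSpace Y] (M : POVM H Y) (φ ψ : H) : ⟪φ, M.effect ∅ ψ⟫_ℂ = 0 := by
  have h := M.hasSum_iUnion (fun _ => ∅) (fun _ => MeasurableSet.empty)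
    (fun i j _ => by simp [Function.onFun]) φ ψ
  exact tendsto_nhds_unique tendsto_const_nhds h.summable.tendsto_atTop_zero

/-- The law `C ↦ tr (M(C) ρ)` of the outcome of the measurement `M` in the state `ρ`. -/
noncomputable def POVM.outcomeLaw {J : ℕ} {Y : Type*} [MeasurableSpace Y] (M : POVM (FockSpace J) Y)
    (ρ : DensityOperator J) : Measure Y :=
  Measure.ofMeasurable (fun C _ => ENNReal.ofReal (fockTrace (M.effect C ∘L ρ.op)).re)
    (by
      obtain ⟨ψ, hψ⟩ := ρ.exists_factor
      simp only [← (hψ _).tsum_eq, M.effect_empty]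
      simp)
    (by
      intro C hC hd
      obtain ⟨ψ, hψ⟩ := ρ.exists_factor
      have key : ∀ D, MeasurableSet D → ENNReal.ofReal (fockTrace (M.effect D ∘L ρ.op)).re
          = ∑' k, ENNReal.ofReal (⟪ψ k, M.effect D (ψ k)⟫_ℂ).re := by
        intro D hD
        have h := Complex.hasSum_re (hψ (M.effect D))
        rw [← h.tsum_eq, ENNReal.ofReal_tsum_of_nonneg _ h.summable]
        exact fun k => (M.positive D hD).re_inner_nonneg_right _
      rw [key _ (MeasurableSet.iUnion hC)]
      simp only [fun n => key _ (hC n)]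
      rw [ENNReal.tsum_comm]
      refine tsum_congr fun k => ?_
      have h := Complex.hasSum_re (M.hasSum_iUnion C hC hd (ψ k) (ψ k))
      rw [← h.tsum_eq, ENNReal.ofReal_tsum_of_nonneg _ h.summable]
      exact fun n => (M.positive _ (hC n)).re_inner_nonneg_right _)

/-- The mean-square error `∫ (b(y) - t)² tr (M(dy) ρ)` of the estimator `b` based on the outcome of
`M`, when the true value is `t` and the state is `ρ`. It may be infinite. -/
noncomputable def POVM.mse {J : ℕ} {Y : Type*} [MeasurableSpace Y] (M : POVM (FockSpace J) Y) (b : Y → ℝ)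
    (ρ : DensityOperator J) (t : ℝ) : ℝ≥0∞ :=
  ∫⁻ y, ENNReal.ofReal ((b y - t) ^ 2) ∂(M.outcomeLaw ρ)

theorem hasSum_fin_prod {J : ℕ} {f : Fin J → ℕ → ℂ} {s : Fin J → ℂ}
    (hf : ∀ j, HasSum (f j) (s j)) (hn : ∀ j, Summable fun k => ‖f j k‖) :
    HasSum (fun m : Fin J → ℕ => ∏ j, f j (m j)) (∏ j, s j) ∧
      Summable fun m : Fin J → ℕ => ‖∏ j, f j (m j)‖ := by
  induction J with
  | zero =>
    refine ⟨?_, Summable.of_finite⟩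
    simpa only [Finset.univ_eq_empty, Finset.prod_empty] using
      hasSum_unique (fun m : Fin 0 → ℕ => ∏ j, f j (m j))
  | succ J ih =>
    obtain ⟨h1, h2⟩ := ih (f := fun j => f j.succ) (fun j => hf j.succ) (fun j => hn j.succ)
    have h3' : Summable fun p : ℕ × (Fin J → ℕ) => f 0 p.1 * ∏ j : Fin J, f j.succ (p.2 j) :=
      summable_mul_of_summable_norm (f := f 0)
        (g := fun m : Fin J → ℕ => ∏ j : Fin J, f j.succ (m j)) (hn 0) h2
    have h3 : HasSum (fun p : ℕ × (Fin J → ℕ) => f 0 p.1 * ∏ j : Fin J, f j.succ (p.2 j))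
        (s 0 * ∏ j : Fin J, s j.succ) :=
      HasSum.mul (f := f 0) (g := fun m : Fin J → ℕ => ∏ j : Fin J, f j.succ (m j)) (hf 0) h1 h3'
    have h4 : Summable fun p : ℕ × (Fin J → ℕ) => ‖f 0 p.1 * ∏ j : Fin J, f j.succ (p.2 j)‖ := by
      simp only [norm_mul]
      exact Summable.mul_of_nonneg (f := fun k => ‖f 0 k‖)
        (g := fun m : Fin J → ℕ => ‖∏ j : Fin J, f j.succ (m j)‖) (hn 0) h2
        (fun _ => norm_nonneg _) (fun _ => norm_nonneg _)
    have e : ∀ p : ℕ × (Fin J → ℕ), ∏ j, f j (Fin.consEquiv (fun _ => ℕ) p j)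
        = f 0 p.1 * ∏ j : Fin J, f j.succ (p.2 j) := fun p => by
      simp [Fin.prod_univ_succ, Fin.consEquiv]
    constructor
    · rw [← (Fin.consEquiv fun _ : Fin (J + 1) => ℕ).hasSum_iff, Fin.prod_univ_succ]
      exact h3.congr_fun e
    · rw [← (Fin.consEquiv fun _ : Fin (J + 1) => ℕ).summable_iff]
      exact h4.congr fun p => by rw [Function.comp_apply, e]

/-- The amplitude `⟨m|α⟩` of a coherent state. -/
noncomputable def coherentAmplitude {J : ℕ} (α : Fin J → ℂ) (m : Fin J → ℕ) : ℂ :=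
  ∏ j, (Real.exp (-‖α j‖ ^ 2 / 2) : ℂ) * (α j ^ m j / (√(m j).factorial : ℂ))

theorem hasSum_coherentAmplitude {J : ℕ} (α β : Fin J → ℂ) :
    HasSum (fun m => starRingEnd ℂ (coherentAmplitude α m) * coherentAmplitude β m)
      (∏ j, ((Real.exp (-‖α j‖ ^ 2 / 2) : ℂ) * (Real.exp (-‖β j‖ ^ 2 / 2) : ℂ) *
        Complex.exp (starRingEnd ℂ (α j) * β j))) ∧
    Summable fun m => ‖starRingEnd ℂ (coherentAmplitude α m) * coherentAmplitude β m‖ := by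
  have key : ∀ m, starRingEnd ℂ (coherentAmplitude α m) * coherentAmplitude β m
      = ∏ j, ((Real.exp (-‖α j‖ ^ 2 / 2) : ℂ) * (Real.exp (-‖β j‖ ^ 2 / 2) : ℂ) *
        ((starRingEnd ℂ (α j) * β j) ^ m j / ((m j).factorial : ℂ))) := by
    intro m
    rw [coherentAmplitude, coherentAmplitude, map_prod, ← Finset.prod_mul_distrib]
    refine Finset.prod_congr rfl fun j _ => ?_
    have h : (√(m j).factorial : ℂ) * (√(m j).factorial : ℂ) = ((m j).factorial : ℂ) := by
      rw [← Complex.ofReal_mul, Real.mul_self_sqrt (Nat.cast_nonneg _)]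
      norm_cast
    rw [← h]
    simp only [map_mul, map_div₀, map_pow, Complex.conj_ofReal]
    rw [mul_pow]
    field_simp
  simp only [key]
  refine hasSum_fin_prod (f := fun j k => (Real.exp (-‖α j‖ ^ 2 / 2) : ℂ) *
    (Real.exp (-‖β j‖ ^ 2 / 2) : ℂ) * ((starRingEnd ℂ (α j) * β j) ^ k / (k.factorial : ℂ)))
    (fun j => ?_) (fun j => ?_)
  · have h := NormedSpace.expSeries_div_hasSum_exp (starRingEnd ℂ (α j) * β j)
    rw [← Complex.exp_eq_exp_ℂ] at h
    exact h.mul_left _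
  · have h := NormedSpace.norm_expSeries_div_summable (starRingEnd ℂ (α j) * β j)
    refine (h.mul_left ‖(Real.exp (-‖α j‖ ^ 2 / 2) : ℂ) * (Real.exp (-‖β j‖ ^ 2 / 2) : ℂ)‖).congr
      fun k => ?_
    rw [← norm_mul]

/-- The coherent state `|α⟩`. -/
noncomputable def coherentState {J : ℕ} (α : Fin J → ℂ) : FockSpace J :=
  ⟨coherentAmplitude α, memℓp_gen (by
    refine (hasSum_coherentAmplitude α α).2.congr fun m => ?_
    simp [pow_two])⟩

theorem coherentState_apply {J : ℕ} (α : Fin J → ℂ) (m : Fin J → ℕ) :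
    coherentState α m = coherentAmplitude α m := rfl

theorem inner_coherentState {J : ℕ} (α β : Fin J → ℂ) :
    ⟪coherentState α, coherentState β⟫_ℂ =
      ∏ j, ((Real.exp (-‖α j‖ ^ 2 / 2) : ℂ) * (Real.exp (-‖β j‖ ^ 2 / 2) : ℂ) *
        Complex.exp (starRingEnd ℂ (α j) * β j)) := by
  rw [lp.inner_eq_tsum, ← (hasSum_coherentAmplitude α β).1.tsum_eq]
  refine tsum_congr fun m => ?_
  simp [coherentState_apply, mul_comm]

theorem norm_coherentState {J : ℕ} (α : Fin J → ℂ) : ‖coherentState α‖ = 1 := by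
  have h : ⟪coherentState α, coherentState α⟫_ℂ = 1 := by
    rw [inner_coherentState]
    refine Finset.prod_eq_one fun j _ => ?_
    rw [Complex.conj_mul']
    push_cast
    rw [← Complex.exp_add, ← Complex.exp_add]
    ring_nf
    simp
  rw [inner_self_eq_norm_sq_to_K] at h
  have h' : ‖coherentState α‖ ^ 2 = 1 := Complex.ofReal_injective (by simpa using h)
  exact (pow_eq_one_iff_of_nonneg (norm_nonneg _) two_ne_zero).1 h'

theorem continuous_coherentState {J : ℕ} :
    Continuous (coherentState : (Fin J → ℂ) → FockSpace J) := by
  rw [continuous_iff_continuousAt]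
  intro α
  rw [ContinuousAt, tendsto_iff_norm_sub_tendsto_zero]
  have h : ∀ β : Fin J → ℂ, ‖coherentState β - coherentState α‖
      = √(2 - 2 * (⟪coherentState β, coherentState α⟫_ℂ).re) := by
    intro β
    rw [← Real.sqrt_sq (norm_nonneg (coherentState β - coherentState α)),
      @norm_sub_sq ℂ, norm_coherentState, norm_coherentState]
    congr 1
    simp only [RCLike.re_to_complex]
    ring
  simp only [h, inner_coherentState]
  have h0 := norm_sub_eq_zero_iff.2 (rfl : coherentState α = coherentState α)
  rw [h α, inner_coherentState] at h0
  rw [← h0]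
  refine Continuous.tendsto ?_ α
  fun_prop

/-- The Gaussian density `exp (-α† Γ⁻¹ α) / det (π Γ)`. -/
noncomputable def thermalDensity {J : ℕ} (Γ : Matrix (Fin J) (Fin J) ℂ) (α : Fin J → ℂ) : ℝ :=
  (((Real.pi : ℂ) • Γ).det.re)⁻¹ * Real.exp (-(star α ⬝ᵥ Γ⁻¹.mulVec α).re)

theorem integral_complex_gaussian {J : ℕ} (μ : Fin J → ℝ) (hμ : ∀ j, 0 < μ j) :
    ∫ β : Fin J → ℂ, Real.exp (-∑ j, (μ j)⁻¹ * ‖β j‖ ^ 2) = ∏ j, (Real.pi * μ j) := by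
  simp only [← Finset.sum_neg_distrib, Real.exp_sum]
  rw [integral_fintype_prod_volume_eq_prod (fun j (z : ℂ) => Real.exp (-((μ j)⁻¹ * ‖z‖ ^ 2)))]
  refine Finset.prod_congr rfl fun j _ => ?_
  have h := GaussianFourier.integral_rexp_neg_mul_sq_norm (V := ℂ) (inv_pos.2 (hμ j))
  simpa [neg_mul, Complex.finrank_real_complex] using h

theorem integral_comp_unitary {J : ℕ} (U : Matrix (Fin J) (Fin J) ℂ)
    (hU : U ∈ Matrix.unitaryGroup (Fin J) ℂ) (f : (Fin J → ℂ) → ℝ) :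
    ∫ β, f (U.mulVec β) = ∫ α, f α := by
  have h1 : star U * U = 1 := (Matrix.mem_unitaryGroup_iff').1 hU
  have h2 : U * star U = 1 := (Matrix.mem_unitaryGroup_iff).1 hU
  let L : (Fin J → ℂ) ≃L[ℝ] (Fin J → ℂ) := LinearEquiv.toContinuousLinearEquiv
    { toFun := U.mulVec
      invFun := (star U).mulVec
      map_add' := U.mulVec_add
      map_smul' := fun c v => U.mulVec_smul c v
      left_inv := fun v => by simp [Matrix.mulVec_mulVec, h1]
      right_inv := fun v => by simp [Matrix.mulVec_mulVec, h2] }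
  have hL : ∀ β, L β = U.mulVec β := fun _ => rfl
  obtain ⟨c, hc⟩ : ∃ c : NNReal, (volume : Measure (Fin J → ℂ)).map L = c • volume :=
    ⟨_, Measure.isAddLeftInvariant_eq_smul _ _⟩
  have hint : ∀ g : (Fin J → ℂ) → ℝ, ∫ β, g (U.mulVec β) = (c : ℝ) * ∫ α, g α := by
    intro g
    have h := integral_map_equiv (μ := volume) L.toHomeomorph.toMeasurableEquiv g
    have e : Measure.map (L.toHomeomorph.toMeasurableEquiv) volume
      = (volume : Measure (Fin J → ℂ)).map L := rfl
    rw [e, hc, integral_smul_nnreal_measure, NNReal.smul_def] at h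
    rw [← smul_eq_mul, h]
    rfl
  have hg := integral_complex_gaussian (fun _ : Fin J => 1) (fun _ => one_pos)
  have hinv : ∀ β, ∑ j, ‖U.mulVec β j‖ ^ 2 = ∑ j, ‖β j‖ ^ 2 := by
    intro β
    have h : star (U.mulVec β) ⬝ᵥ U.mulVec β = star β ⬝ᵥ β := by
      rw [Matrix.star_mulVec, Matrix.dotProduct_mulVec, Matrix.vecMul_vecMul,
        ← Matrix.star_eq_conjTranspose, h1, Matrix.vecMul_one]
    have e : ∀ v : Fin J → ℂ, star v ⬝ᵥ v = ((∑ j, ‖v j‖ ^ 2 : ℝ) : ℂ) := by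
      intro v
      simp [dotProduct, Complex.conj_mul']
    rw [e, e] at h
    exact_mod_cast h
  have h := hint fun α => Real.exp (-∑ j, (1 : ℝ)⁻¹ * ‖α j‖ ^ 2)
  simp only [← Finset.mul_sum, hinv] at h hg
  rw [hg] at h
  have hpos : (0 : ℝ) < ∏ _j : Fin J, (Real.pi * 1) :=
    Finset.prod_pos fun _ _ => mul_pos Real.pi_pos one_pos
  have hc1 : (c : ℝ) = 1 := by
    field_simp at h
    linarith
  rw [hint, hc1, one_mul]

theorem thermalDensity_nonneg {J : ℕ} {Γ : Matrix (Fin J) (Fin J) ℂ} (hΓ : Γ.PosDef)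
    (α : Fin J → ℂ) : 0 ≤ thermalDensity Γ α := by
  refine mul_nonneg (inv_nonneg.2 ?_) (Real.exp_pos _).le
  have hp : (0 : ℂ) < (Real.pi : ℂ) := by exact_mod_cast Real.pi_pos
  exact (Complex.pos_iff.1 (hΓ.smul hp).det_pos).1.le

theorem integral_thermalDensity {J : ℕ} {Γ : Matrix (Fin J) (Fin J) ℂ} (hΓ : Γ.PosDef) :
    ∫ α, thermalDensity Γ α = 1 := by
  set U : Matrix (Fin J) (Fin J) ℂ := (hΓ.1.eigenvectorUnitary : Matrix (Fin J) (Fin J) ℂ) with hU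
  set μ := hΓ.1.eigenvalues with hμ
  have hμp : ∀ j, 0 < μ j := hΓ.eigenvalues_pos
  have hUm : U ∈ Matrix.unitaryGroup (Fin J) ℂ := hΓ.1.eigenvectorUnitary.2
  have h1 : star U * U = 1 := (Matrix.mem_unitaryGroup_iff').1 hUm
  have h2 : U * star U = 1 := (Matrix.mem_unitaryGroup_iff).1 hUm
  have hspec : Γ = U * Matrix.diagonal (fun j => (μ j : ℂ)) * star U := by
    have := hΓ.1.spectral_theorem
    rw [Unitary.conjStarAlgAut_apply] at this
    exact this
  have hinv : Γ⁻¹ = U * Matrix.diagonal (fun j => ((μ j)⁻¹ : ℂ)) * star U := by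
    refine Matrix.inv_eq_right_inv ?_
    have hd : Matrix.diagonal (fun j => (μ j : ℂ)) * Matrix.diagonal (fun j => ((μ j)⁻¹ : ℂ))
        = 1 := by
      rw [Matrix.diagonal_mul_diagonal, ← Matrix.diagonal_one]
      congr 1
      ext j
      exact mul_inv_cancel₀ (by exact_mod_cast (hμp j).ne')
    calc Γ * (U * Matrix.diagonal (fun j => ((μ j)⁻¹ : ℂ)) * star U)
        = U * Matrix.diagonal (fun j => (μ j : ℂ)) * (star U * U) *
          Matrix.diagonal (fun j => ((μ j)⁻¹ : ℂ)) * star U := by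
          conv_lhs => rw [hspec]
          simp only [Matrix.mul_assoc]
      _ = 1 := by rw [h1, Matrix.mul_one, Matrix.mul_assoc U, hd, Matrix.mul_one, h2]
  have hdet : ((Real.pi : ℂ) • Γ).det.re = ∏ j, (Real.pi * μ j) := by
    have : ((Real.pi : ℂ) • Γ).det = ((∏ j, (Real.pi * μ j) : ℝ) : ℂ) := by
      rw [Matrix.det_smul, hΓ.1.det_eq_prod_eigenvalues, Finset.prod_mul_distrib]
      simp [hμ]
    rw [this, Complex.ofReal_re]
  have hq : ∀ β : Fin J → ℂ, (star (U.mulVec β) ⬝ᵥ Γ⁻¹.mulVec (U.mulVec β)).re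
      = ∑ j, (μ j)⁻¹ * ‖β j‖ ^ 2 := by
    intro β
    have e : star (U.mulVec β) ⬝ᵥ Γ⁻¹.mulVec (U.mulVec β)
        = star β ⬝ᵥ (Matrix.diagonal fun j => ((μ j)⁻¹ : ℂ)).mulVec β := by
      rw [hinv, Matrix.mulVec_mulVec, Matrix.mul_assoc, h1, Matrix.mul_one,
        ← Matrix.mulVec_mulVec, Matrix.star_mulVec, ← Matrix.star_eq_conjTranspose,
        Matrix.dotProduct_mulVec, Matrix.vecMul_vecMul, h1, Matrix.vecMul_one]
    rw [e]
    simp only [dotProduct, Matrix.mulVec_diagonal, Complex.re_sum]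
    refine Finset.sum_congr rfl fun j _ => ?_
    have : star β j * ((μ j : ℂ)⁻¹ * β j) = (((μ j)⁻¹ * ‖β j‖ ^ 2 : ℝ) : ℂ) := by
      push_cast
      rw [← Complex.conj_mul']
      simp only [Pi.star_apply, RCLike.star_def]
      ring
    rw [this, Complex.ofReal_re]
  rw [← integral_comp_unitary U hUm]
  simp only [thermalDensity, hq, hdet]
  rw [integral_const_mul, integral_complex_gaussian μ hμp]
  exact inv_mul_cancel₀ (Finset.prod_pos fun j _ => mul_pos Real.pi_pos (hμp j)).ne'

theorem integrable_thermalDensity {J : ℕ} {Γ : Matrix (Fin J) (Fin J) ℂ} (hΓ : Γ.PosDef) :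
    Integrable (thermalDensity Γ) := by
  by_contra h
  have := integral_undef h
  rw [integral_thermalDensity hΓ] at this
  exact one_ne_zero this

/-- The operator `∫ Φ(α) |α⟩⟨α| d²α`, a Bochner integral in operator norm; the reference measure is
the product over the modes of `d(Re α_j) d(Im α_j)`. -/
noncomputable def thermalOp {J : ℕ} (Γ : Matrix (Fin J) (Fin J) ℂ) :
    FockSpace J →L[ℂ] FockSpace J :=
  ∫ α : Fin J → ℂ, (thermalDensity Γ α : ℂ) •
    InnerProductSpace.rankOne ℂ (coherentState α) (coherentState α)

theorem integrable_thermalOp {J : ℕ} {Γ : Matrix (Fin J) (Fin J) ℂ} (hΓ : Γ.PosDef) :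
    Integrable fun α : Fin J → ℂ => (thermalDensity Γ α : ℂ) •
      InnerProductSpace.rankOne ℂ (coherentState α) (coherentState α) := by
  have hc : Continuous fun α : Fin J → ℂ =>
      InnerProductSpace.rankOne ℂ (coherentState α) (coherentState α) :=
    ((ContinuousLinearMap.smulRightL ℂ (FockSpace J) (FockSpace J)).continuous.comp
      ((innerSL ℂ).continuous.comp continuous_coherentState)).clm_apply continuous_coherentState
  have hm : AEStronglyMeasurable (fun α : Fin J → ℂ => (thermalDensity Γ α : ℂ) •
      InnerProductSpace.rankOne ℂ (coherentState α) (coherentState α)) volume :=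
    (Complex.continuous_ofReal.comp_aestronglyMeasurable
      (integrable_thermalDensity hΓ).aestronglyMeasurable).smul hc.aestronglyMeasurable
  refine Integrable.mono' (integrable_thermalDensity hΓ) hm
    (Filter.Eventually.of_forall fun α => ?_)
  rw [norm_smul, InnerProductSpace.norm_rankOne, norm_coherentState, Complex.norm_real,
    Real.norm_of_nonneg (thermalDensity_nonneg hΓ α)]
  simp

theorem inner_thermalOp {J : ℕ} {Γ : Matrix (Fin J) (Fin J) ℂ} (hΓ : Γ.PosDef)
    (φ : FockSpace J) : ⟪φ, thermalOp Γ φ⟫_ℂ =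
      ((∫ α, thermalDensity Γ α * ‖⟪φ, coherentState α⟫_ℂ‖ ^ 2 : ℝ) : ℂ) := by
  have h := ((innerSL ℂ φ).comp
    (ContinuousLinearMap.apply ℂ (FockSpace J) φ)).integral_comp_comm (integrable_thermalOp hΓ)
  rw [← integral_complex_ofReal]
  refine h.symm.trans (integral_congr_ae (Filter.Eventually.of_forall fun α => ?_))
  have e : ⟪coherentState α, φ⟫_ℂ * ⟪φ, coherentState α⟫_ℂ
      = ((‖⟪φ, coherentState α⟫_ℂ‖ ^ 2 : ℝ) : ℂ) := by
    rw [← inner_conj_symm (coherentState α), Complex.conj_mul']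
    norm_cast
  simp [e]

theorem isPositive_thermalOp {J : ℕ} {Γ : Matrix (Fin J) (Fin J) ℂ} (hΓ : Γ.PosDef) :
    (thermalOp Γ).IsPositive := by
  rw [← ContinuousLinearMap.isPositive_toLinearMap_iff, LinearMap.isPositive_iff_complex]
  intro φ
  have h := inner_thermalOp hΓ φ
  have h0 : (0 : ℝ) ≤ ∫ α, thermalDensity Γ α * ‖⟪φ, coherentState α⟫_ℂ‖ ^ 2 :=
    integral_nonneg fun α => mul_nonneg (thermalDensity_nonneg hΓ α) (sq_nonneg _)
  rw [ContinuousLinearMap.coe_coe, ← inner_conj_symm, h, Complex.conj_ofReal]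
  exact ⟨rfl, h0⟩

theorem hasSum_thermalOp {J : ℕ} {Γ : Matrix (Fin J) (Fin J) ℂ} (hΓ : Γ.PosDef) :
    HasSum (fun m => ⟪fockState m, thermalOp Γ (fockState m)⟫_ℂ) 1 := by
  simp only [inner_thermalOp hΓ]
  rw [← Complex.ofReal_one, Complex.hasSum_ofReal, ← integral_thermalDensity hΓ]
  have hs : ∀ α : Fin J → ℂ, HasSum
      (fun m => thermalDensity Γ α * ‖⟪fockState m, coherentState α⟫_ℂ‖ ^ 2)
      (thermalDensity Γ α) := by
    intro α
    have h := (hasSum_norm_sq_inner (fockBasis J) (coherentState α)).mul_left (thermalDensity Γ α)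
    simpa only [fockBasis_apply, norm_coherentState, one_pow, mul_one] using h
  refine hasSum_integral_of_dominated_convergence
    (fun m α => thermalDensity Γ α * ‖⟪fockState m, coherentState α⟫_ℂ‖ ^ 2)
    (fun m => ?_) (fun m => Filter.Eventually.of_forall fun α => ?_)
    (Filter.Eventually.of_forall fun α => (hs α).summable) ?_
    (Filter.Eventually.of_forall hs)
  · refine (integrable_thermalDensity hΓ).aestronglyMeasurable.mul
      (Continuous.aestronglyMeasurable ?_)
    exact ((continuous_const.inner continuous_coherentState).norm).pow 2
  · rw [Real.norm_of_nonneg (mul_nonneg (thermalDensity_nonneg hΓ α) (sq_nonneg _))]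
  · simpa only [fun α => (hs α).tsum_eq] using integrable_thermalDensity hΓ

/-- The multimode thermal state with mutual coherence matrix `Γ`. -/
noncomputable def thermalState {J : ℕ} (Γ : Matrix (Fin J) (Fin J) ℂ) (hΓ : Γ.PosDef) :
    DensityOperator J where
  op := thermalOp Γ
  positive := isPositive_thermalOp hΓ
  trace_one := hasSum_thermalOp hΓ

/-- The creation operator of the `k`-th original mode, on the vectors with finitely many nonzero
amplitudes: `|m⟩ ↦ √(m_k + 1) |m + e_k⟩`. -/
noncomputable def creation {J : ℕ} (k : Fin J) : Module.End ℂ ((Fin J → ℕ) →₀ ℂ) :=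
  Finsupp.linearCombination ℂ fun m => Finsupp.single (m + Pi.single k 1) (√(m k + 1 : ℝ) : ℂ)

/-- The creation operator `∑ k, V_kj a_k†` of the `j`-th mode defined by `V`, so that the mode
function is the `j`-th column of `V`; the annihilation operator is `∑ k, conj(V_kj) a_k`. -/
noncomputable def modeCreation {J : ℕ} (V : Matrix (Fin J) (Fin J) ℂ) (j : Fin J) :
    Module.End ℂ ((Fin J → ℕ) →₀ ℂ) :=
  ∑ k, V k j • creation k

/-- The inclusion of the vectors with finitely many nonzero amplitudes into the Fock space. -/
noncomputable def toFockSpace {J : ℕ} (f : (Fin J → ℕ) →₀ ℂ) : FockSpace J :=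
  f.sum fun m c => c • fockState m

/-- The photon-number state `∏ j, (g_j†)^(m_j) / √(m_j!) |0⟩` of the modes defined by `V`, where
`g_j†` is the creation operator of the `j`-th such mode. -/
noncomputable def modeFockState {J : ℕ} (V : Matrix (Fin J) (Fin J) ℂ) (m : Fin J → ℕ) :
    FockSpace J :=
  toFockSpace ((∏ j, (√(m j).factorial : ℂ)⁻¹) •
    (List.ofFn fun j => modeCreation V j ^ m j).prod (Finsupp.single 0 1))

/-- `N` counts the photons in each of the modes defined by `V`: the outcome `m` has the effect
`|m, g⟩⟨m, g|`, with `|m, g⟩` the photon-number state of these modes. -/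
def IsEigenmodePhotonCounting {J : ℕ} (V : Matrix (Fin J) (Fin J) ℂ)
    (N : POVM (FockSpace J) (Fin J → ℕ)) : Prop :=
  ∀ m, N.effect {m} = InnerProductSpace.rankOne ℂ (modeFockState V m) (modeFockState V m)

/-!
The mean-square error of a measurement is affine in the state. If all the states `ρ` of a family are
diagonal in one fixed Hilbert basis `e`, with eigenvalues `p m`, then every measurement `M` sees `ρ`
as a mixture of the pure states `|e m⟩⟨e m|` with weights `p m`
(`POVM.outcomeLaw_eq_sum`, `POVM.mse_eq_tsum`). The measurement in the basis `e` has the outcome `m`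
with certainty in the state `e m`, so that it may be followed by the estimator `b' m`, the mean of
`b` under the law of `M` in the state `e m`. This estimator does not involve the eigenvalues, and on
each `e m` its squared error is at most the mean squared error of `b`, by Jensen's inequality
(`ofReal_sq_integral_sub_le_lintegral`). Summing over `m` gives `POVM.mse_measurement_le`.

It remains to see that the photon-number states `|m, g⟩` of the eigenmodes form a Hilbert basis of
eigenvectors of every thermal state `ρ_Γ` with `Γ = V D V†`, `D` diagonal. Everything follows from
`⟨m, g|Vβ⟩ = ⟨m|β⟩` (`inner_modeFockState_coherentState`), which holds because coherent states are
eigenvectors of the annihilation operators. The change of variables `α = V β` then reduces matrix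
elements of `ρ_Γ` to those of `ρ_D` (`inner_thermalOp_unitary_conj`), and the latter is diagonal in
the original photon-number basis by invariance under phase rotations
(`inner_thermalOp_diagonal_of_ne`). Its diagonal elements do not vanish, which shows that the
coherent states are total (`eq_zero_of_inner_coherentState_eq_zero`). Hence each `|m, g⟩` is an
eigenvector of `ρ_Γ` (`thermalOp_modeFockState`), the case `Γ = 1` gives orthonormality
(`orthonormal_modeFockState`), and Parseval's identity for coherent states gives completeness
(`span_modeFockState_orthogonal`). No eigenvalue needs to be computed.
-/

/-! ### Matrix elements of thermal operators -/

theorem integrable_inner_thermalOp {J : ℕ} {Γ : Matrix (Fin J) (Fin J) ℂ} (hΓ : Γ.PosDef)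
    (φ ψ : FockSpace J) : Integrable fun α : Fin J → ℂ =>
      (thermalDensity Γ α : ℂ) * (⟪φ, coherentState α⟫_ℂ * ⟪coherentState α, ψ⟫_ℂ) := by
  have h := ((innerSL ℂ φ).comp
    (ContinuousLinearMap.apply ℂ (FockSpace J) ψ)).integrable_comp (integrable_thermalOp hΓ)
  refine h.congr (Filter.Eventually.of_forall fun α => ?_)
  simp [mul_comm]

theorem inner_thermalOp_eq_integral {J : ℕ} {Γ : Matrix (Fin J) (Fin J) ℂ} (hΓ : Γ.PosDef)
    (φ ψ : FockSpace J) : ⟪φ, thermalOp Γ ψ⟫_ℂ = ∫ α,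
      (thermalDensity Γ α : ℂ) * (⟪φ, coherentState α⟫_ℂ * ⟪coherentState α, ψ⟫_ℂ) := by
  have h := ((innerSL ℂ φ).comp
    (ContinuousLinearMap.apply ℂ (FockSpace J) ψ)).integral_comp_comm (integrable_thermalOp hΓ)
  refine h.symm.trans (integral_congr_ae (Filter.Eventually.of_forall fun α => ?_))
  simp [mul_comm]

theorem thermalDensity_unitary_conj {J : ℕ} {V : Matrix (Fin J) (Fin J) ℂ}
    (hV : V ∈ Matrix.unitaryGroup (Fin J) ℂ) (D : Matrix (Fin J) (Fin J) ℂ) (β : Fin J → ℂ) :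
    thermalDensity (V * D * V.conjTranspose) (V.mulVec β) = thermalDensity D β := by
  have h1 : V.conjTranspose * V = 1 := (Matrix.mem_unitaryGroup_iff').1 hV
  have hVi : V⁻¹ = V.conjTranspose := Matrix.inv_eq_left_inv h1
  have hVi' : V.conjTranspose⁻¹ = V := Matrix.inv_eq_right_inv h1
  have hdet : ((Real.pi : ℂ) • (V * D * V.conjTranspose)).det = ((Real.pi : ℂ) • D).det := by
    rw [Matrix.det_smul, Matrix.det_smul, Matrix.det_mul_right_comm,
      mul_eq_one_comm.1 h1, Matrix.one_mul]
  have hq : star (V.mulVec β) ⬝ᵥ (V * D * V.conjTranspose)⁻¹.mulVec (V.mulVec β)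
      = star β ⬝ᵥ D⁻¹.mulVec β := by
    rw [Matrix.mul_inv_rev, Matrix.mul_inv_rev, hVi, hVi', Matrix.mulVec_mulVec,
      Matrix.mul_assoc, Matrix.mul_assoc, h1, Matrix.mul_one, ← Matrix.mulVec_mulVec,
      Matrix.star_mulVec, Matrix.dotProduct_mulVec, Matrix.vecMul_vecMul, h1, Matrix.vecMul_one]
  rw [thermalDensity, thermalDensity, hdet, hq]

/-- Change of variables `α = V β` in the matrix elements of a thermal operator. -/
theorem inner_thermalOp_unitary_conj {J : ℕ} {V D : Matrix (Fin J) (Fin J) ℂ}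
    (hV : V ∈ Matrix.unitaryGroup (Fin J) ℂ) (hD : D.PosDef)
    (hΓ : (V * D * V.conjTranspose).PosDef) {φ ψ φ' ψ' : FockSpace J} {c : ℂ}
    (h : ∀ β, ⟪φ, coherentState (V.mulVec β)⟫_ℂ * ⟪coherentState (V.mulVec β), ψ⟫_ℂ
      = c * (⟪φ', coherentState β⟫_ℂ * ⟪coherentState β, ψ'⟫_ℂ)) :
    ⟪φ, thermalOp (V * D * V.conjTranspose) ψ⟫_ℂ = c * ⟪φ', thermalOp D ψ'⟫_ℂ := by
  have i1 := integrable_inner_thermalOp hΓ φ ψ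
  have i2 := (integrable_inner_thermalOp hD φ' ψ').const_mul c
  rw [inner_thermalOp_eq_integral hΓ, inner_thermalOp_eq_integral hD, ← integral_const_mul]
  have key : ∀ β, (thermalDensity (V * D * V.conjTranspose) (V.mulVec β) : ℂ) *
      (⟪φ, coherentState (V.mulVec β)⟫_ℂ * ⟪coherentState (V.mulVec β), ψ⟫_ℂ)
      = c * ((thermalDensity D β : ℂ) *
        (⟪φ', coherentState β⟫_ℂ * ⟪coherentState β, ψ'⟫_ℂ)) := fun β => by
    rw [h, thermalDensity_unitary_conj hV]
    ring
  -- The change of variables is available for real integrands only.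
  refine Complex.ext ?_ ?_
  · rw [← RCLike.re_to_complex, ← integral_re i1, ← RCLike.re_to_complex, ← integral_re i2,
      ← integral_comp_unitary V hV]
    simp only [key]
  · rw [← RCLike.im_to_complex, ← integral_im i1, ← RCLike.im_to_complex, ← integral_im i2,
      ← integral_comp_unitary V hV]
    simp only [key]

/-! ### Coherent states and thermal operators in the photon-number basis -/

theorem inner_fockState {J : ℕ} (m : Fin J → ℕ) (ψ : FockSpace J) : ⟪fockState m, ψ⟫_ℂ = ψ m := by
  rw [← fockBasis_apply, ← HilbertBasis.repr_apply_apply]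
  rfl

theorem inner_fockState_coherentState {J : ℕ} (m : Fin J → ℕ) (α : Fin J → ℂ) :
    ⟪fockState m, coherentState α⟫_ℂ = coherentAmplitude α m := inner_fockState m _

theorem coherentAmplitude_diagonal_mulVec {J : ℕ} {u : Fin J → ℂ} (hu : ∀ j, ‖u j‖ = 1)
    (β : Fin J → ℂ) (m : Fin J → ℕ) :
    coherentAmplitude ((Matrix.diagonal u).mulVec β) m
      = (∏ j, u j ^ m j) * coherentAmplitude β m := by
  rw [coherentAmplitude, coherentAmplitude, ← Finset.prod_mul_distrib]
  refine Finset.prod_congr rfl fun j _ => ?_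
  rw [Matrix.mulVec_diagonal, norm_mul, hu, one_mul, mul_pow]
  ring

/-- A thermal operator of uncorrelated modes is diagonal in the photon-number basis: a rotation of
the phase of one mode in which `m` and `n` differ leaves the density unchanged and, for a suitable
angle, flips the sign of the integrand. -/
theorem inner_thermalOp_diagonal_of_ne {J : ℕ} {d : Fin J → ℂ}
    (hD : (Matrix.diagonal d).PosDef) {m n : Fin J → ℕ} (hmn : m ≠ n) :
    ⟪fockState m, thermalOp (Matrix.diagonal d) (fockState n)⟫_ℂ = 0 := by
  obtain ⟨i, hi⟩ := Function.ne_iff.1 hmn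
  -- The angle for which the phases of `m` and `n` differ by `π`.
  set θ : ℝ := Real.pi / ((m i : ℝ) - n i) with hθ
  have hne : ((m i : ℝ) - n i) ≠ 0 := sub_ne_zero.2 (by exact_mod_cast hi)
  set w : ℂ := Complex.exp (θ * Complex.I) with hw
  have hwn : ‖w‖ = 1 := Complex.norm_exp_ofReal_mul_I θ
  have hwc : w ^ m i * (starRingEnd ℂ w) ^ n i = -1 := by
    rw [hw, ← Complex.exp_conj, ← Complex.exp_nat_mul, ← Complex.exp_nat_mul, ← Complex.exp_add,
      ← Complex.exp_pi_mul_I]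
    congr 1
    have : (Real.pi : ℂ) = θ * ((m i : ℂ) - n i) := by
      rw [hθ]
      have hne' : ((m i : ℂ) - n i) ≠ 0 := by exact_mod_cast hne
      push_cast
      field_simp
    rw [this]
    simp only [map_mul, Complex.conj_ofReal, Complex.conj_I]
    ring
  set u : Fin J → ℂ := Function.update 1 i w with hu
  have hun : ∀ j, ‖u j‖ = 1 := fun j => by
    by_cases h : j = i
    · subst h; simp [hu, hwn]
    · simp [hu, h]
  have hprod : ∀ k : Fin J → ℕ, ∏ j, u j ^ k j = w ^ k i := fun k => by
    rw [Finset.prod_eq_single i]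
    · simp [hu]
    · intro j _ hj
      simp [hu, hj]
    · simp
  have hU : Matrix.diagonal u ∈ Matrix.unitaryGroup (Fin J) ℂ := by
    rw [Matrix.mem_unitaryGroup_iff, Matrix.star_eq_conjTranspose, Matrix.diagonal_conjTranspose,
      Matrix.diagonal_mul_diagonal, ← Matrix.diagonal_one]
    congr 1
    ext j
    simp [Complex.mul_conj', hun]
  have hUD : Matrix.diagonal u * Matrix.diagonal d * (Matrix.diagonal u).conjTranspose
      = Matrix.diagonal d := by
    rw [Matrix.diagonal_conjTranspose, Matrix.diagonal_mul_diagonal, Matrix.diagonal_mul_diagonal]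
    congr 1
    ext j
    have : u j * starRingEnd ℂ (u j) = 1 := by simp [Complex.mul_conj', hun]
    simp only [Pi.star_apply, RCLike.star_def]
    linear_combination d j * this
  have h := inner_thermalOp_unitary_conj (φ := fockState m) (ψ := fockState n)
    (φ' := fockState m) (ψ' := fockState n) (c := -1) hU hD (by rwa [hUD]) fun β => by
      rw [← inner_conj_symm _ (fockState n), ← inner_conj_symm _ (fockState n)]
      simp only [inner_fockState_coherentState, coherentAmplitude_diagonal_mulVec hun, hprod,
        map_mul, map_pow]
      rw [← hwc]
      ring
  rw [hUD] at h
  linear_combination h / 2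

theorem thermalDensity_pos {J : ℕ} {Γ : Matrix (Fin J) (Fin J) ℂ} (hΓ : Γ.PosDef)
    (α : Fin J → ℂ) : 0 < thermalDensity Γ α := by
  refine mul_pos (inv_pos.2 ?_) (Real.exp_pos _)
  have hp : (0 : ℂ) < (Real.pi : ℂ) := by exact_mod_cast Real.pi_pos
  exact (Complex.pos_iff.1 (hΓ.smul hp).det_pos).1

/-- The diagonal elements of a thermal operator in the photon-number basis do not vanish: they are
integrals of continuous nonnegative functions that are positive at `α = (1, ..., 1)`. -/
theorem inner_fockState_thermalOp_self_ne_zero {J : ℕ} {Γ : Matrix (Fin J) (Fin J) ℂ}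
    (hΓ : Γ.PosDef) (m : Fin J → ℕ) : ⟪fockState m, thermalOp Γ (fockState m)⟫_ℂ ≠ 0 := by
  rw [inner_thermalOp hΓ, Complex.ofReal_ne_zero]
  have hd : Continuous (thermalDensity Γ) := by
    unfold thermalDensity
    fun_prop
  have hc : Continuous fun α => thermalDensity Γ α * ‖⟪fockState m, coherentState α⟫_ℂ‖ ^ 2 :=
    hd.mul ((continuous_const.inner continuous_coherentState).norm.pow 2)
  have hi : Integrable fun α => thermalDensity Γ α * ‖⟪fockState m, coherentState α⟫_ℂ‖ ^ 2 := by
    refine (integrable_inner_thermalOp hΓ (fockState m) (fockState m)).norm.congr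
      (Filter.Eventually.of_forall fun α => ?_)
    simp only [norm_mul, Complex.norm_real, Real.norm_of_nonneg (thermalDensity_nonneg hΓ α)]
    rw [norm_inner_symm (coherentState α), pow_two]
  have h0 : ∀ α, 0 ≤ thermalDensity Γ α * ‖⟪fockState m, coherentState α⟫_ℂ‖ ^ 2 := fun α =>
    mul_nonneg (thermalDensity_nonneg hΓ α) (sq_nonneg _)
  refine (integral_pos_of_integrable_nonneg_nonzero hc hi h0 (x := 1) ?_).ne'
  refine mul_ne_zero (thermalDensity_pos hΓ _).ne' (pow_ne_zero 2 (norm_ne_zero_iff.2 ?_))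
  rw [inner_fockState_coherentState, coherentAmplitude]
  refine Finset.prod_ne_zero_iff.2 fun j _ => ?_
  have : √((m j).factorial : ℝ) ≠ 0 := by positivity
  simp [this]

/-- The thermal operator of uncorrelated modes acts diagonally on photon-number states. -/
theorem thermalOp_diagonal_fockState {J : ℕ} {d : Fin J → ℂ} (hD : (Matrix.diagonal d).PosDef)
    (m : Fin J → ℕ) : thermalOp (Matrix.diagonal d) (fockState m)
      = ⟪fockState m, thermalOp (Matrix.diagonal d) (fockState m)⟫_ℂ • fockState m := by
  ext n
  rw [← inner_fockState n, ← inner_fockState n, inner_smul_right]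
  by_cases h : n = m
  · subst h
    have : ⟪fockState n, fockState n⟫_ℂ = 1 := by
      rw [← fockBasis_apply, inner_self_eq_norm_sq_to_K, (fockBasis J).orthonormal.1]
      simp
    rw [this, mul_one]
  · rw [inner_thermalOp_diagonal_of_ne hD h, ← fockBasis_apply, ← fockBasis_apply,
      (fockBasis J).orthonormal.2 h, mul_zero]

theorem posDef_diagonal_one {J : ℕ} : (Matrix.diagonal (1 : Fin J → ℂ)).PosDef := by
  rw [show Matrix.diagonal (1 : Fin J → ℂ) = 1 from Matrix.diagonal_one]
  exact Matrix.PosDef.one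

/-- The coherent states are total: a vector orthogonal to all of them is annihilated by a thermal
operator, which is diagonal in the photon-number basis with nonzero eigenvalues. -/
theorem eq_zero_of_inner_coherentState_eq_zero {J : ℕ} {ψ : FockSpace J}
    (h : ∀ α : Fin J → ℂ, ⟪coherentState α, ψ⟫_ℂ = 0) : ψ = 0 := by
  have h1 := posDef_diagonal_one (J := J)
  ext m
  have h2 : ⟪fockState m, thermalOp (Matrix.diagonal 1) ψ⟫_ℂ = 0 := by
    rw [inner_thermalOp_eq_integral h1]
    simp [h]
  rw [← (isPositive_thermalOp h1).inner_left_eq_inner_right, thermalOp_diagonal_fockState h1,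
    inner_smul_left, mul_eq_zero, inner_fockState m ψ] at h2
  exact h2.resolve_left
    ((map_ne_zero _).2 (inner_fockState_thermalOp_self_ne_zero h1 m))

/-! ### Photon-number states of the eigenmodes -/

theorem inner_coherentState_toFockSpace {J : ℕ} (α : Fin J → ℂ) (f : (Fin J → ℕ) →₀ ℂ) :
    ⟪coherentState α, toFockSpace f⟫_ℂ = Finsupp.linearCombination ℂ
      (fun m => starRingEnd ℂ (coherentAmplitude α m)) f := by
  rw [toFockSpace, Finsupp.sum, inner_sum, Finsupp.linearCombination_apply, Finsupp.sum]
  refine Finset.sum_congr rfl fun m _ => ?_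
  rw [inner_smul_right, ← inner_conj_symm, inner_fockState_coherentState, smul_eq_mul]

theorem sqrt_mul_coherentAmplitude_add_single {J : ℕ} (α : Fin J → ℂ) (m : Fin J → ℕ)
    (k : Fin J) : (√(m k + 1 : ℝ) : ℂ) * coherentAmplitude α (m + Pi.single k 1)
      = α k * coherentAmplitude α m := by
  rw [coherentAmplitude, coherentAmplitude, ← Finset.mul_prod_erase _ _ (Finset.mem_univ k),
    ← Finset.mul_prod_erase (a := k) _ _ (Finset.mem_univ k)]
  have h1 : (√(((m + Pi.single k 1 : Fin J → ℕ) k).factorial : ℝ) : ℂ)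
      = (√(m k + 1 : ℝ) : ℂ) * (√((m k).factorial : ℝ) : ℂ) := by
    rw [← Complex.ofReal_mul, ← Real.sqrt_mul (by positivity)]
    simp [Nat.factorial_succ]
  have h2 : (√(m k + 1 : ℝ) : ℂ) ≠ 0 := by
    rw [Complex.ofReal_ne_zero]
    positivity
  have h3 : (√((m k).factorial : ℝ) : ℂ) ≠ 0 := by
    rw [Complex.ofReal_ne_zero]
    positivity
  have h4 : ∏ j ∈ Finset.univ.erase k, (Real.exp (-‖α j‖ ^ 2 / 2) : ℂ) *
      (α j ^ (m + Pi.single k 1 : Fin J → ℕ) j /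
        (√((m + Pi.single k 1 : Fin J → ℕ) j).factorial : ℂ))
      = ∏ j ∈ Finset.univ.erase k, (Real.exp (-‖α j‖ ^ 2 / 2) : ℂ) *
        (α j ^ m j / (√(m j).factorial : ℂ)) := by
    refine Finset.prod_congr rfl fun j hj => ?_
    simp [Finset.ne_of_mem_erase hj]
  rw [h4, h1]
  simp only [Pi.add_apply, Pi.single_eq_same, pow_succ]
  field_simp

/-- A coherent state is an eigenvector of the annihilation operators. -/
theorem inner_coherentState_creation {J : ℕ} (α : Fin J → ℂ) (k : Fin J)
    (f : (Fin J → ℕ) →₀ ℂ) : ⟪coherentState α, toFockSpace (creation k f)⟫_ℂ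
      = starRingEnd ℂ (α k) * ⟪coherentState α, toFockSpace f⟫_ℂ := by
  rw [inner_coherentState_toFockSpace, inner_coherentState_toFockSpace]
  induction f using Finsupp.induction_linear with
  | zero => simp
  | add f g hf hg => rw [map_add, map_add, map_add, hf, hg, mul_add]
  | single m c =>
    rw [creation, Finsupp.linearCombination_single, map_smul, Finsupp.linearCombination_single,
      Finsupp.linearCombination_single]
    have h := congrArg (starRingEnd ℂ) (sqrt_mul_coherentAmplitude_add_single α m k)
    simp only [map_mul, Complex.conj_ofReal] at h
    simp only [smul_eq_mul]
    linear_combination c * h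

theorem inner_coherentState_modeCreation {J : ℕ} (V : Matrix (Fin J) (Fin J) ℂ) (α : Fin J → ℂ)
    (j : Fin J) (f : (Fin J → ℕ) →₀ ℂ) : ⟪coherentState α, toFockSpace (modeCreation V j f)⟫_ℂ
      = starRingEnd ℂ (V.conjTranspose.mulVec α j) * ⟪coherentState α, toFockSpace f⟫_ℂ := by
  have h := fun k => inner_coherentState_creation α k f
  simp only [inner_coherentState_toFockSpace] at h ⊢
  simp only [modeCreation, LinearMap.sum_apply, LinearMap.smul_apply, map_sum, map_smul, h,
    Matrix.mulVec, dotProduct, Finset.sum_mul, map_mul, Matrix.conjTranspose_apply,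
    RCLike.star_def, Complex.conj_conj, smul_eq_mul, mul_assoc]

/-- If each operator `F j` multiplies the value of `A` by `c j`, then the ordered product of their
powers multiplies it by the product of the powers of the `c j`; the `F j` need not commute. -/
theorem prod_ofFn_pow_of_eigen {n : ℕ} {E : Type*} [AddCommGroup E] [Module ℂ E]
    (A : E → ℂ) (F : Fin n → Module.End ℂ E) (c : Fin n → ℂ) (m : Fin n → ℕ)
    (h : ∀ j f, A (F j f) = c j * A f) (f : E) :
    A ((List.ofFn fun j => F j ^ m j).prod f) = (∏ j, c j ^ m j) * A f := by
  have hp : ∀ j k f, A ((F j ^ k) f) = c j ^ k * A f := fun j k => by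
    induction k with
    | zero => simp
    | succ k ih =>
      intro f
      rw [pow_succ, Module.End.mul_apply, ih, h, pow_succ, mul_assoc]
  induction n with
  | zero => simp
  | succ n ih =>
    rw [List.ofFn_succ, List.prod_cons, Module.End.mul_apply, hp, Fin.prod_univ_succ, mul_assoc,
      ih (fun j => F j.succ) (fun j => c j.succ) (fun j => m j.succ) (fun j => h j.succ)
        (fun j => hp j.succ)]

theorem sum_norm_sq_unitary_mulVec {J : ℕ} {V : Matrix (Fin J) (Fin J) ℂ}
    (hV : V ∈ Matrix.unitaryGroup (Fin J) ℂ) (β : Fin J → ℂ) :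
    ∑ j, ‖V.mulVec β j‖ ^ 2 = ∑ j, ‖β j‖ ^ 2 := by
  have h1 : star V * V = 1 := (Matrix.mem_unitaryGroup_iff').1 hV
  have h : star (V.mulVec β) ⬝ᵥ V.mulVec β = star β ⬝ᵥ β := by
    rw [Matrix.star_mulVec, Matrix.dotProduct_mulVec, Matrix.vecMul_vecMul,
      ← Matrix.star_eq_conjTranspose, h1, Matrix.vecMul_one]
  have e : ∀ v : Fin J → ℂ, star v ⬝ᵥ v = ((∑ j, ‖v j‖ ^ 2 : ℝ) : ℂ) := fun v => by
    simp [dotProduct, Complex.conj_mul']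
  rw [e, e] at h
  exact_mod_cast h

/-- The coherent states `|α⟩` and `|Vα⟩` have the same vacuum amplitude. -/
theorem prod_exp_norm_sq_unitary_mulVec {J : ℕ} {V : Matrix (Fin J) (Fin J) ℂ}
    (hV : V ∈ Matrix.unitaryGroup (Fin J) ℂ) (α : Fin J → ℂ) :
    ∏ j, (Real.exp (-‖V.mulVec α j‖ ^ 2 / 2) : ℂ) = ∏ j, (Real.exp (-‖α j‖ ^ 2 / 2) : ℂ) := by
  rw [← Complex.ofReal_prod, ← Complex.ofReal_prod, ← Real.exp_sum, ← Real.exp_sum,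
    ← Finset.sum_div, ← Finset.sum_div, Finset.sum_neg_distrib, Finset.sum_neg_distrib,
    sum_norm_sq_unitary_mulVec hV]

/-- The coherent state `|Vβ⟩` has, in the photon-number states of the modes defined by `V`, the
amplitudes that `|β⟩` has in those of the original modes. -/
theorem inner_modeFockState_coherentState {J : ℕ} {V : Matrix (Fin J) (Fin J) ℂ}
    (hV : V ∈ Matrix.unitaryGroup (Fin J) ℂ) (m : Fin J → ℕ) (β : Fin J → ℂ) :
    ⟪modeFockState V m, coherentState (V.mulVec β)⟫_ℂ = coherentAmplitude β m := by
  have h1 : V.conjTranspose * V = 1 := (Matrix.mem_unitaryGroup_iff').1 hV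
  have hlin : ∀ (c : ℂ) (f : (Fin J → ℕ) →₀ ℂ),
      ⟪coherentState (V.mulVec β), toFockSpace (c • f)⟫_ℂ
        = c * ⟪coherentState (V.mulVec β), toFockSpace f⟫_ℂ := fun c f => by
    rw [inner_coherentState_toFockSpace, inner_coherentState_toFockSpace, map_smul, smul_eq_mul]
  have hvac : ⟪coherentState (V.mulVec β), toFockSpace (Finsupp.single 0 1)⟫_ℂ
      = ∏ j, (Real.exp (-‖β j‖ ^ 2 / 2) : ℂ) := by
    rw [inner_coherentState_toFockSpace, Finsupp.linearCombination_single,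
      ← prod_exp_norm_sq_unitary_mulVec hV]
    simp only [coherentAmplitude, Pi.zero_apply, pow_zero, Nat.factorial_zero, Nat.cast_one,
      Real.sqrt_one, Complex.ofReal_one, div_one, mul_one, map_prod, Complex.conj_ofReal,
      smul_eq_mul, one_mul]
  rw [← inner_conj_symm, modeFockState, hlin,
    prod_ofFn_pow_of_eigen (fun f => ⟪coherentState (V.mulVec β), toFockSpace f⟫_ℂ) (modeCreation V)
      (fun j => starRingEnd ℂ (V.conjTranspose.mulVec (V.mulVec β) j)) m
      (inner_coherentState_modeCreation V _), hvac, Matrix.mulVec_mulVec, h1, Matrix.one_mulVec,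
    ← Finset.prod_mul_distrib, ← Finset.prod_mul_distrib, map_prod, coherentAmplitude]
  refine Finset.prod_congr rfl fun j _ => ?_
  simp only [map_mul, map_pow, map_inv₀, Complex.conj_ofReal, Complex.conj_conj]
  ring

theorem inner_coherentState_unitary {J : ℕ} {V : Matrix (Fin J) (Fin J) ℂ}
    (hV : V ∈ Matrix.unitaryGroup (Fin J) ℂ) (β γ : Fin J → ℂ) :
    ⟪coherentState (V.mulVec β), coherentState (V.mulVec γ)⟫_ℂ
      = ⟪coherentState β, coherentState γ⟫_ℂ := by
  have h1 : star V * V = 1 := (Matrix.mem_unitaryGroup_iff').1 hV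
  have hi : ∑ j, starRingEnd ℂ (V.mulVec β j) * V.mulVec γ j
      = ∑ j, starRingEnd ℂ (β j) * γ j := by
    change star (V.mulVec β) ⬝ᵥ V.mulVec γ = star β ⬝ᵥ γ
    rw [Matrix.star_mulVec, Matrix.dotProduct_mulVec, Matrix.vecMul_vecMul,
      ← Matrix.star_eq_conjTranspose, h1, Matrix.vecMul_one]
  simp only [inner_coherentState, Finset.prod_mul_distrib,
    prod_exp_norm_sq_unitary_mulVec hV, ← Complex.exp_sum, hi]

/-- A thermal operator whose eigenmodes are those defined by `V` has, in their photon-number states,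
the matrix elements that the thermal operator of the spectrum has in the original ones. -/
theorem inner_modeFockState_thermalOp {J : ℕ} {V D : Matrix (Fin J) (Fin J) ℂ}
    (hV : V ∈ Matrix.unitaryGroup (Fin J) ℂ) (hD : D.PosDef)
    (hΓ : (V * D * V.conjTranspose).PosDef) (m n : Fin J → ℕ) :
    ⟪modeFockState V m, thermalOp (V * D * V.conjTranspose) (modeFockState V n)⟫_ℂ
      = ⟪fockState m, thermalOp D (fockState n)⟫_ℂ := by
  have h := inner_thermalOp_unitary_conj (φ := modeFockState V m) (ψ := modeFockState V n)
    (φ' := fockState m) (ψ' := fockState n) (c := 1) hV hD hΓ fun β => by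
      rw [← inner_conj_symm _ (modeFockState V n), ← inner_conj_symm _ (fockState n)]
      simp only [inner_modeFockState_coherentState hV, inner_fockState_coherentState, one_mul]
  rwa [one_mul] at h

/-- The photon-number states of the eigenmodes are eigenvectors of the thermal operator: by totality,
it suffices to compare inner products with the coherent states `|Vβ⟩`. -/
theorem thermalOp_modeFockState {J : ℕ} {V : Matrix (Fin J) (Fin J) ℂ} {d : Fin J → ℂ}
    (hV : V ∈ Matrix.unitaryGroup (Fin J) ℂ) (hD : (Matrix.diagonal d).PosDef)
    (hΓ : (V * Matrix.diagonal d * V.conjTranspose).PosDef) (m : Fin J → ℕ) :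
    thermalOp (V * Matrix.diagonal d * V.conjTranspose) (modeFockState V m)
      = ⟪fockState m, thermalOp (Matrix.diagonal d) (fockState m)⟫_ℂ • modeFockState V m := by
  have h1 : V * V.conjTranspose = 1 := (Matrix.mem_unitaryGroup_iff).1 hV
  have hc : ∀ β n, ⟪coherentState (V.mulVec β), modeFockState V n⟫_ℂ
      = ⟪coherentState β, fockState n⟫_ℂ := fun β n => by
    rw [← inner_conj_symm, ← inner_conj_symm (coherentState β),
      inner_modeFockState_coherentState hV, inner_fockState_coherentState]
  rw [← sub_eq_zero]
  refine eq_zero_of_inner_coherentState_eq_zero fun α => ?_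
  rw [show α = V.mulVec (V.conjTranspose.mulVec α) by simp [Matrix.mulVec_mulVec, h1]]
  have h := inner_thermalOp_unitary_conj
    (φ := coherentState (V.mulVec (V.conjTranspose.mulVec α))) (ψ := modeFockState V m)
    (φ' := coherentState (V.conjTranspose.mulVec α)) (ψ' := fockState m) (c := 1) hV hD hΓ
    fun γ => by rw [hc, inner_coherentState_unitary hV, one_mul]
  have h' := congrArg (inner ℂ (coherentState (V.conjTranspose.mulVec α)))
    (thermalOp_diagonal_fockState hD m)
  rw [inner_smul_right] at h'
  rw [inner_sub_right, h, inner_smul_right, hc, one_mul, h', sub_self]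

/-- The photon-number states of the modes defined by `V` are orthonormal: they are eigenvectors of
a thermal operator whose density is invariant under `V`, with the nonzero eigenvalues that the
orthonormal photon-number states of the original modes have. -/
theorem orthonormal_modeFockState {J : ℕ} {V : Matrix (Fin J) (Fin J) ℂ}
    (hV : V ∈ Matrix.unitaryGroup (Fin J) ℂ) : Orthonormal ℂ (modeFockState V) := by
  have h1 : V * V.conjTranspose = 1 := (Matrix.mem_unitaryGroup_iff).1 hV
  have hI := posDef_diagonal_one (J := J)
  have hΓ : (V * Matrix.diagonal (1 : Fin J → ℂ) * V.conjTranspose).PosDef := by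
    rw [show Matrix.diagonal (1 : Fin J → ℂ) = 1 from Matrix.diagonal_one, Matrix.mul_one, h1]
    exact Matrix.PosDef.one
  refine orthonormal_iff_ite.2 fun m n => ?_
  have h2 := inner_modeFockState_thermalOp hV hI hΓ m n
  have h3 := congrArg (inner ℂ (fockState m)) (thermalOp_diagonal_fockState hI n)
  rw [thermalOp_modeFockState hV hI hΓ, inner_smul_right, h3, inner_smul_right] at h2
  rw [mul_left_cancel₀ (inner_fockState_thermalOp_self_ne_zero hI n) h2, ← fockBasis_apply,
    ← fockBasis_apply, orthonormal_iff_ite.1 (fockBasis J).orthonormal]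

/-- The span of the photon-number states of the modes defined by `V` is dense: by Parseval its
closure contains every coherent state. -/
theorem span_modeFockState_orthogonal {J : ℕ} {V : Matrix (Fin J) (Fin J) ℂ}
    (hV : V ∈ Matrix.unitaryGroup (Fin J) ℂ) :
    (Submodule.span ℂ (Set.range (modeFockState V)))ᗮ = ⊥ := by
  have h1 : V * V.conjTranspose = 1 := (Matrix.mem_unitaryGroup_iff).1 hV
  refine (Submodule.eq_bot_iff _).2 fun ψ hψ => eq_zero_of_inner_coherentState_eq_zero fun α => ?_
  rw [show α = V.mulVec (V.conjTranspose.mulVec α) by simp [Matrix.mulVec_mulVec, h1]]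
  set β := V.conjTranspose.mulVec α
  -- `W` sends the photon-number states of the original modes to those of the modes defined by `V`.
  -- It sends `|β⟩` to `|Vβ⟩`, since both are unit vectors and their inner product is `1`.
  set W := (orthonormal_modeFockState hV).orthogonalFamily.linearIsometry with hW
  have hs : HasSum (fun m => coherentAmplitude β m • modeFockState V m) (W (coherentState β)) :=
    (orthonormal_modeFockState hV).orthogonalFamily.hasSum_linearIsometry (coherentState β)
  have hx : coherentState (V.mulVec β) = W (coherentState β) := by
    refine (inner_eq_one_iff_of_norm_eq_one (𝕜 := ℂ) (norm_coherentState _)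
      (by rw [W.norm_map, norm_coherentState])).1 ?_
    refine (hs.mapL (innerSL ℂ (coherentState (V.mulVec β)))).unique ?_
    have h := (fockBasis J).hasSum_inner_mul_inner (coherentState β) (coherentState β)
    rw [inner_self_eq_norm_sq_to_K, norm_coherentState] at h
    convert h using 1
    · ext m
      rw [innerSL_apply_apply, inner_smul_right, fockBasis_apply, ← inner_conj_symm,
        inner_modeFockState_coherentState hV, ← inner_conj_symm (coherentState β),
        inner_fockState_coherentState, mul_comm]
    · simp
  rw [hx, ← inner_conj_symm]
  refine (map_eq_zero _).2 ((hs.mapL (innerSL ℂ ψ)).unique ?_)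
  convert hasSum_zero with m
  have : ⟪modeFockState V m, ψ⟫_ℂ = 0 := hψ _ (Submodule.subset_span ⟨m, rfl⟩)
  rw [innerSL_apply_apply, inner_smul_right, ← inner_conj_symm, this, map_zero, mul_zero]

/-- The photon-number states of the modes defined by the unitary matrix `V`, as a Hilbert basis. -/
noncomputable def modeFockBasis {J : ℕ} {V : Matrix (Fin J) (Fin J) ℂ}
    (hV : V ∈ Matrix.unitaryGroup (Fin J) ℂ) : HilbertBasis (Fin J → ℕ) ℂ (FockSpace J) :=
  HilbertBasis.mkOfOrthogonalEqBot (orthonormal_modeFockState hV)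
    (span_modeFockState_orthogonal hV)

theorem modeFockBasis_apply {J : ℕ} {V : Matrix (Fin J) (Fin J) ℂ}
    (hV : V ∈ Matrix.unitaryGroup (Fin J) ℂ) (m : Fin J → ℕ) :
    modeFockBasis hV m = modeFockState V m := by
  rw [modeFockBasis, HilbertBasis.coe_mkOfOrthogonalEqBot]

/-! ### Traces of states that are diagonal in a Hilbert basis -/

theorem DensityOperator.eigenvalue_nonneg {J : ℕ} (ρ : DensityOperator J) {e : FockSpace J}
    (he : ‖e‖ = 1) {p : ℝ} (h : ρ.op e = (p : ℂ) • e) : 0 ≤ p := by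
  have h1 := ρ.positive.re_inner_nonneg_right e
  rw [h, inner_smul_right, inner_self_eq_norm_sq_to_K, he] at h1
  simpa using h1

/-- The eigenvalues with respect to the Hilbert basis `e` are summable. As the trace of a state is
defined in the photon-number basis, this compares double sums of the nonnegative numbers
`p m * |⟨e m|n⟩|²`. -/
theorem DensityOperator.summable_eigenvalues {J : ℕ} {ι : Type*} (ρ : DensityOperator J)
    (e : HilbertBasis ι ℂ (FockSpace J)) {p : ι → ℝ} (h : ∀ m, ρ.op (e m) = (p m : ℂ) • e m) :
    Summable p := by
  have hp : ∀ m, 0 ≤ p m := fun m => ρ.eigenvalue_nonneg (e.orthonormal.1 m) (h m)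
  have h1 : ∀ n, HasSum (fun m => p m * ‖⟪e m, fockState n⟫_ℂ‖ ^ 2)
      (⟪fockState n, ρ.op (fockState n)⟫_ℂ).re := fun n => by
    have h2 := Complex.hasSum_re (e.hasSum_inner_mul_inner (fockState n) (ρ.op (fockState n)))
    refine h2.congr_fun fun m => ?_
    rw [← ρ.positive.inner_left_eq_inner_right, h, inner_smul_left, ← inner_conj_symm _ (e m),
      mul_left_comm, Complex.conj_mul', Complex.conj_ofReal]
    norm_cast
  have h3 := Complex.hasSum_re ρ.trace_one
  have h4 : Summable fun q : (Fin J → ℕ) × ι => p q.2 * ‖⟪e q.2, fockState q.1⟫_ℂ‖ ^ 2 := by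
    refine (summable_prod_of_nonneg fun q => mul_nonneg (hp _) (sq_nonneg _)).2
      ⟨fun n => (h1 n).summable, ?_⟩
    exact h3.summable.congr fun n => (h1 n).tsum_eq.symm
  have h5 : Summable fun q : ι × (Fin J → ℕ) => p q.1 * ‖⟪e q.1, fockState q.2⟫_ℂ‖ ^ 2 :=
    (Equiv.prodComm ι (Fin J → ℕ)).summable_iff.2 h4
  refine h5.prod.congr fun m => ?_
  have h6 := (hasSum_norm_sq_inner (fockBasis J) (e m)).mul_left (p m)
  rw [e.orthonormal.1 m, one_pow, mul_one] at h6
  rw [← h6.tsum_eq]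
  refine tsum_congr fun n => ?_
  simp [fockBasis_apply, norm_inner_symm (e m)]

/-- In a state that is diagonal in the Hilbert basis `e`, the trace `tr (T ρ)` is the mean of the
diagonal elements of `T` with respect to `e`. -/
theorem DensityOperator.hasSum_fockTrace {J : ℕ} {ι : Type*} (ρ : DensityOperator J)
    (e : HilbertBasis ι ℂ (FockSpace J)) {p : ι → ℝ} (h : ∀ m, ρ.op (e m) = (p m : ℂ) • e m)
    (T : FockSpace J →L[ℂ] FockSpace J) :
    HasSum (fun m => (p m : ℂ) * ⟪e m, T (e m)⟫_ℂ) (fockTrace (T ∘L ρ.op)) := by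
  have hp : ∀ m, 0 ≤ p m := fun m => ρ.eigenvalue_nonneg (e.orthonormal.1 m) (h m)
  have key : ∀ m, HasSum (fun n => p m * (‖⟪fockState n, T (e m)⟫_ℂ‖ ^ 2
      + ‖⟪fockState n, e m⟫_ℂ‖ ^ 2)) (p m * (‖T (e m)‖ ^ 2 + 1)) := fun m => by
    have h1 := (hasSum_norm_sq_inner (fockBasis J) (T (e m))).add
      (hasSum_norm_sq_inner (fockBasis J) (e m))
    rw [e.orthonormal.1 m, one_pow] at h1
    simpa only [fockBasis_apply] using h1.mul_left (p m)
  -- The double sum over both bases converges absolutely, so that its order may be exchanged.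
  have hG : Summable fun q : ι × (Fin J → ℕ) => p q.1 *
      (‖⟪fockState q.2, T (e q.1)⟫_ℂ‖ ^ 2 + ‖⟪fockState q.2, e q.1⟫_ℂ‖ ^ 2) := by
    refine (summable_prod_of_nonneg fun q =>
      mul_nonneg (hp _) (add_nonneg (sq_nonneg _) (sq_nonneg _))).2
        ⟨fun m => (key m).summable, ?_⟩
    refine Summable.congr ?_ fun m => (key m).tsum_eq.symm
    refine Summable.of_nonneg_of_le (fun m => mul_nonneg (hp m) (by positivity)) (fun m => ?_)
      ((ρ.summable_eigenvalues e h).mul_right (‖T‖ ^ 2 + 1))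
    have h1 : ‖T (e m)‖ ≤ ‖T‖ := by
      simpa [e.orthonormal.1 m] using T.le_opNorm (e m)
    have := hp m
    gcongr
  have hF : Summable fun q : ι × (Fin J → ℕ) =>
      (p q.1 : ℂ) * (⟪e q.1, fockState q.2⟫_ℂ * ⟪fockState q.2, T (e q.1)⟫_ℂ) := by
    refine Summable.of_norm_bounded hG fun q => ?_
    rw [norm_mul, norm_mul, norm_inner_symm (e q.1), Complex.norm_real,
      Real.norm_of_nonneg (hp _)]
    refine mul_le_mul_of_nonneg_left ?_ (hp _)
    nlinarith [two_mul_le_add_sq ‖⟪fockState q.2, T (e q.1)⟫_ℂ‖ ‖⟪fockState q.2, e q.1⟫_ℂ‖,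
      norm_nonneg ⟪fockState q.2, T (e q.1)⟫_ℂ, norm_nonneg ⟪fockState q.2, e q.1⟫_ℂ]
  have h2 : ∀ n, HasSum
      (fun m => (p m : ℂ) * (⟪e m, fockState n⟫_ℂ * ⟪fockState n, T (e m)⟫_ℂ))
      ⟪fockState n, (T ∘L ρ.op) (fockState n)⟫_ℂ := fun n => by
    have h1 := e.hasSum_inner_mul_inner (T.adjoint (fockState n)) (ρ.op (fockState n))
    rw [ContinuousLinearMap.adjoint_inner_left] at h1
    refine h1.congr_fun fun m => ?_
    rw [← ρ.positive.inner_left_eq_inner_right, h, inner_smul_left, Complex.conj_ofReal,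
      ContinuousLinearMap.adjoint_inner_left]
    ring
  have h3 := hF.hasSum.prod_fiberwise fun m => by
    have h1 := ((fockBasis J).hasSum_inner_mul_inner (e m) (T (e m))).mul_left (p m : ℂ)
    simpa only [fockBasis_apply] using h1
  have h4 := ((Equiv.prodComm (Fin J → ℕ) ι).hasSum_iff.2 hF.hasSum).prod_fiberwise h2
  rw [fockTrace, h4.tsum_eq]
  exact h3

/-! ### Pure states and mixtures -/

/-- The pure state `|e⟩⟨e|` of a unit vector `e`. -/
noncomputable def pureState {J : ℕ} (e : FockSpace J) (he : ‖e‖ = 1) : DensityOperator J where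
  op := InnerProductSpace.rankOne ℂ e e
  positive := InnerProductSpace.isPositive_rankOne_self e
  trace_one := by
    have h := (fockBasis J).hasSum_inner_mul_inner e e
    rw [inner_self_eq_norm_sq_to_K, he] at h
    simpa [fockBasis_apply, inner_smul_right] using h

theorem fockTrace_comp_pureState {J : ℕ} {e : FockSpace J} (he : ‖e‖ = 1)
    (T : FockSpace J →L[ℂ] FockSpace J) :
    fockTrace (T ∘L (pureState e he).op) = ⟪e, T e⟫_ℂ := by
  rw [← ((fockBasis J).hasSum_inner_mul_inner e (T e)).tsum_eq, fockTrace]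
  refine tsum_congr fun n => ?_
  simp [pureState, fockBasis_apply]

theorem POVM.outcomeLaw_apply {J : ℕ} {Y : Type*} [MeasurableSpace Y] (M : POVM (FockSpace J) Y)
    (ρ : DensityOperator J) {C : Set Y} (hC : MeasurableSet C) :
    M.outcomeLaw ρ C = ENNReal.ofReal (fockTrace (M.effect C ∘L ρ.op)).re :=
  Measure.ofMeasurable_apply C hC

theorem POVM.outcomeLaw_pureState_apply {J : ℕ} {Y : Type*} [MeasurableSpace Y]
    (M : POVM (FockSpace J) Y) {e : FockSpace J} (he : ‖e‖ = 1) {C : Set Y}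
    (hC : MeasurableSet C) :
    M.outcomeLaw (pureState e he) C = ENNReal.ofReal (⟪e, M.effect C e⟫_ℂ).re := by
  rw [M.outcomeLaw_apply _ hC, fockTrace_comp_pureState]

theorem POVM.isProbabilityMeasure_outcomeLaw_pureState {J : ℕ} {Y : Type*} [MeasurableSpace Y]
    (M : POVM (FockSpace J) Y) {e : FockSpace J} (he : ‖e‖ = 1) :
    IsProbabilityMeasure (M.outcomeLaw (pureState e he)) := by
  refine ⟨?_⟩
  rw [M.outcomeLaw_pureState_apply he MeasurableSet.univ, M.effect_univ,
    one_apply_eq_self, inner_self_eq_norm_sq_to_K, he]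
  simp

/-- In a state that is diagonal in the Hilbert basis `e`, the outcome of any measurement is
distributed as if the state were the pure state `e m` with probability `p m`. -/
theorem POVM.outcomeLaw_eq_sum {J : ℕ} {ι Y : Type*} [MeasurableSpace Y]
    (M : POVM (FockSpace J) Y) (ρ : DensityOperator J) (e : HilbertBasis ι ℂ (FockSpace J))
    {p : ι → ℝ} (h : ∀ m, ρ.op (e m) = (p m : ℂ) • e m) :
    M.outcomeLaw ρ = Measure.sum fun m =>
      ENNReal.ofReal (p m) • M.outcomeLaw (pureState (e m) (e.orthonormal.1 m)) := by
  ext C hC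
  have hp : ∀ m, 0 ≤ p m := fun m => ρ.eigenvalue_nonneg (e.orthonormal.1 m) (h m)
  have h0 : ∀ m, 0 ≤ (⟪e m, M.effect C (e m)⟫_ℂ).re := fun m =>
    (M.positive C hC).re_inner_nonneg_right _
  have h1 := Complex.hasSum_re (ρ.hasSum_fockTrace e h (M.effect C))
  simp only [Complex.re_ofReal_mul] at h1
  rw [Measure.sum_apply _ hC, M.outcomeLaw_apply ρ hC, ← h1.tsum_eq,
    ENNReal.ofReal_tsum_of_nonneg (fun m => mul_nonneg (hp m) (h0 m)) h1.summable]
  refine tsum_congr fun m => ?_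
  rw [ENNReal.ofReal_mul (hp m), Measure.smul_apply, M.outcomeLaw_pureState_apply _ hC, smul_eq_mul]

theorem POVM.mse_eq_tsum {J : ℕ} {ι Y : Type*} [MeasurableSpace Y]
    (M : POVM (FockSpace J) Y) (b : Y → ℝ) (ρ : DensityOperator J) (t : ℝ)
    (e : HilbertBasis ι ℂ (FockSpace J)) {p : ι → ℝ} (h : ∀ m, ρ.op (e m) = (p m : ℂ) • e m) :
    M.mse b ρ t = ∑' m, ENNReal.ofReal (p m) *
      M.mse b (pureState (e m) (e.orthonormal.1 m)) t := by
  rw [POVM.mse, M.outcomeLaw_eq_sum ρ e h, lintegral_sum_measure]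
  refine tsum_congr fun m => ?_
  rw [lintegral_smul_measure, POVM.mse, smul_eq_mul]

/-- The squared error of the mean of `b` is at most the mean squared error of `b`, also where the
latter is infinite. -/
theorem ofReal_sq_integral_sub_le_lintegral {Y : Type*} [MeasurableSpace Y] (μ : Measure Y)
    [IsProbabilityMeasure μ] {b : Y → ℝ} (hb : Measurable b) (t : ℝ) :
    ENNReal.ofReal ((∫ y, b y ∂μ - t) ^ 2) ≤ ∫⁻ y, ENNReal.ofReal ((b y - t) ^ 2) ∂μ := by
  by_cases hi : Integrable (fun y => (b y - t) ^ 2) μ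
  · have hL : MemLp (fun y => b y - t) 2 μ :=
      (memLp_two_iff_integrable_sq (hb.sub_const t).aestronglyMeasurable).2 hi
    have hbi : Integrable b μ := by
      refine ((hL.integrable one_le_two).add (integrable_const t)).congr
        (Filter.Eventually.of_forall fun y => ?_)
      simp
    have hv := ProbabilityTheory.variance_nonneg (fun y => b y - t) μ
    rw [ProbabilityTheory.variance_eq_sub hL, integral_sub hbi (integrable_const t)] at hv
    rw [← ofReal_integral_eq_lintegral_ofReal hi (Filter.Eventually.of_forall fun y => sq_nonneg _)]
    refine ENNReal.ofReal_le_ofReal ?_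
    simpa using hv
  · have hm : AEStronglyMeasurable (fun y => (b y - t) ^ 2) μ :=
      ((hb.sub_const t).pow_const 2).aestronglyMeasurable
    have : ∫⁻ y, ENNReal.ofReal ((b y - t) ^ 2) ∂μ = ∞ := by
      by_contra hne
      refine hi ⟨hm, (hasFiniteIntegral_iff_ofReal ?_).2 (lt_top_iff_ne_top.2 hne)⟩
      exact Filter.Eventually.of_forall fun y => sq_nonneg _
    rw [this]
    exact le_top

/-! ### Measurement in a Hilbert basis -/

section BasisMeasurement

variable {ι H : Type*} [NormedAddCommGroup H] [InnerProductSpace ℂ H] [CompleteSpace H]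

/-- The projection onto the closed span of the basis vectors with index in `C`. -/
noncomputable def basisProjection (e : HilbertBasis ι ℂ H) (C : Set ι) : H →L[ℂ] H :=
  (Submodule.span ℂ (e '' C)).topologicalClosure.starProjection

theorem inner_basisProjection (e : HilbertBasis ι ℂ H) (C : Set ι) (m : ι) (ψ : H) :
    ⟪e m, basisProjection e C ψ⟫_ℂ = C.indicator (fun m => ⟪e m, ψ⟫_ℂ) m := by
  by_cases hm : m ∈ C
  · have h : e m ∈ (Submodule.span ℂ (e '' C)).topologicalClosure :=
      Submodule.le_topologicalClosure _ (Submodule.subset_span ⟨m, hm, rfl⟩)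
    rw [Set.indicator_of_mem hm, basisProjection, ← Submodule.inner_starProjection_left_eq_right,
      Submodule.starProjection_eq_self_iff.2 h]
  · have h : e m ∈ (Submodule.span ℂ (e '' C)).topologicalClosureᗮ := by
      rw [Submodule.orthogonal_closure, Submodule.mem_orthogonal]
      intro u hu
      induction hu using Submodule.span_induction with
      | mem u hu =>
        obtain ⟨n, hn, rfl⟩ := hu
        exact e.orthonormal.2 fun hnm => hm (hnm ▸ hn)
      | zero => exact inner_zero_left _
      | add u v _ _ hu hv => rw [inner_add_left, hu, hv, add_zero]
      | smul c u _ hu => rw [inner_smul_left, hu, mul_zero]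
    rw [Set.indicator_of_notMem hm, basisProjection, ← Submodule.inner_starProjection_left_eq_right,
      (Submodule.starProjection_apply_eq_zero_iff _).2 h, inner_zero_left]

theorem hasSum_inner_basisProjection (e : HilbertBasis ι ℂ H) (C : Set ι) (φ ψ : H) :
    HasSum (C.indicator fun m => ⟪φ, e m⟫_ℂ * ⟪e m, ψ⟫_ℂ) ⟪φ, basisProjection e C ψ⟫_ℂ := by
  refine (e.hasSum_inner_mul_inner φ (basisProjection e C ψ)).congr_fun fun m => ?_
  rw [inner_basisProjection]
  by_cases hm : m ∈ C <;> simp [hm]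

/-- The measurement whose outcome `m` has the effect `|e m⟩⟨e m|`. -/
noncomputable def HilbertBasis.measurement [MeasurableSpace ι] (e : HilbertBasis ι ℂ H) :
    POVM H ι where
  effect := basisProjection e
  positive C _ := (ContinuousLinearMap.nonneg_iff_isPositive _).1
    isStarProjection_starProjection.nonneg
  effect_univ := by
    ext ψ
    refine ext_inner_left ℂ fun φ => (hasSum_inner_basisProjection e Set.univ φ ψ).unique ?_
    simpa using e.hasSum_inner_mul_inner φ ψ
  hasSum_iUnion C _ hd φ ψ := by
    have h := hasSum_subtype_iff_indicator.2 (hasSum_inner_basisProjection e (⋃ n, C n) φ ψ)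
    refine ((Set.unionEqSigmaOfDisjoint hd).symm.hasSum_iff.2 h).sigma fun n => ?_
    exact hasSum_subtype_iff_indicator.2 (hasSum_inner_basisProjection e (C n) φ ψ)

theorem HilbertBasis.measurement_effect_singleton [MeasurableSpace ι] (e : HilbertBasis ι ℂ H)
    (m : ι) : e.measurement.effect {m} = InnerProductSpace.rankOne ℂ (e m) (e m) := by
  ext ψ
  refine ext_inner_left ℂ fun φ => (hasSum_inner_basisProjection e {m} φ ψ).unique ?_
  rw [InnerProductSpace.rankOne_apply, inner_smul_right, mul_comm]
  convert hasSum_single m fun n hn => ?_ using 1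
  · simp
  · simp [hn]

end BasisMeasurement

theorem HilbertBasis.outcomeLaw_measurement_pureState {J : ℕ} {ι : Type*} [MeasurableSpace ι]
    (e : HilbertBasis ι ℂ (FockSpace J)) (m : ι) :
    e.measurement.outcomeLaw (pureState (e m) (e.orthonormal.1 m)) = Measure.dirac m := by
  ext C hC
  rw [POVM.outcomeLaw_pureState_apply _ _ hC, Measure.dirac_apply' _ hC]
  change ENNReal.ofReal (⟪e m, basisProjection e C (e m)⟫_ℂ).re = _
  rw [inner_basisProjection]
  by_cases hm : m ∈ C
  · rw [Set.indicator_of_mem hm, Set.indicator_of_mem hm, inner_self_eq_norm_sq_to_K,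
      e.orthonormal.1 m]
    simp
  · simp [hm]

/-- Measuring the Hilbert basis `e` and estimating by the conditional mean of `b` given `e m` is,
in every state that is diagonal in `e`, at least as good as measuring `M` and estimating by `b`. -/
theorem POVM.mse_measurement_le {J : ℕ} {ι Y : Type*} [MeasurableSpace ι]
    [MeasurableSingletonClass ι] [MeasurableSpace Y] (M : POVM (FockSpace J) Y) {b : Y → ℝ}
    (hb : Measurable b) (ρ : DensityOperator J) (t : ℝ) (e : HilbertBasis ι ℂ (FockSpace J))
    {p : ι → ℝ} (h : ∀ m, ρ.op (e m) = (p m : ℂ) • e m) :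
    e.measurement.mse (fun m => ∫ y, b y ∂M.outcomeLaw (pureState (e m) (e.orthonormal.1 m))) ρ t
      ≤ M.mse b ρ t := by
  rw [POVM.mse_eq_tsum _ _ ρ t e h, POVM.mse_eq_tsum M b ρ t e h]
  refine ENNReal.tsum_le_tsum fun m => mul_le_mul_right ?_ _
  have := M.isProbabilityMeasure_outcomeLaw_pureState (e.orthonormal.1 m)
  rw [POVM.mse, e.outcomeLaw_measurement_pureState, lintegral_dirac]
  exact ofReal_sq_integral_sub_le_lintegral _ hb t

/-! ### Optimality of photon counting in the eigenmodes -/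

theorem mainTheorem9 {J : ℕ} {X : Type*}
    (Γ : X → Matrix (Fin J) (Fin J) ℂ) (hΓ : ∀ x, (Γ x).PosDef)
    (V : Matrix (Fin J) (Fin J) ℂ) (hV : V ∈ Matrix.unitaryGroup (Fin J) ℂ)
    (lam : X → Fin J → ℝ)
    (hdiag : ∀ x, Γ x = V * Matrix.diagonal (fun j => (lam x j : ℂ)) * V.conjTranspose)
    (a : X → ℝ) :
    ∃ N : POVM (FockSpace J) (Fin J → ℕ), IsEigenmodePhotonCounting V N ∧
      ∀ {Y : Type*} [MeasurableSpace Y] (M : POVM (FockSpace J) Y) (b : Y → ℝ), Measurable b →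
        ∃ b' : (Fin J → ℕ) → ℝ, ∀ x,
          N.mse b' (thermalState (Γ x) (hΓ x)) (a x) ≤
            M.mse b (thermalState (Γ x) (hΓ x)) (a x) := by
  refine ⟨(modeFockBasis hV).measurement, fun m => ?_, fun {Y} _ M b hb => ⟨_, fun x =>
    M.mse_measurement_le hb _ _ (modeFockBasis hV)
      (p := fun m => (⟪fockState m, thermalOp (Matrix.diagonal fun j => (lam x j : ℂ))
        (fockState m)⟫_ℂ).re) fun m => ?_⟩⟩
  · rw [HilbertBasis.measurement_effect_singleton, modeFockBasis_apply]
  · have h1 : V.conjTranspose * V = 1 := (Matrix.mem_unitaryGroup_iff').1 hV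
    have hG := hΓ x
    rw [hdiag x] at hG
    have hD : (Matrix.diagonal fun j => (lam x j : ℂ)).PosDef := by
      have hinj : Function.Injective V.mulVec := fun u v huv => by
        simpa [Matrix.mulVec_mulVec, h1] using congrArg V.conjTranspose.mulVec huv
      have h := hG.conjTranspose_mul_mul_same hinj
      rwa [Matrix.mul_assoc, Matrix.mul_assoc, h1, Matrix.mul_one, ← Matrix.mul_assoc, h1,
        Matrix.one_mul] at h
    change thermalOp (Γ x) _ = _
    rw [hdiag x, modeFockBasis_apply, thermalOp_modeFockState hV hD hG, inner_thermalOp hD,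
      Complex.ofReal_re]
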